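/- Let $F$ be a global field (a finite extension of $\mathbb{Q}$ or of $\mathbb{F}_p(T)$ for a prime $p$), with algebraic closure $\overline{F}$. A place of $F$ is an equivalence class of non-trivial absolute values on $F$. Let $S$ be a finite set of $r$ places of $F$ which contains all archimedean places (if $F$ has positive characteristic there are none, and $S$ is an arbitrary finite set of places, possibly empty). For an absolute value $w$ on $\overline{F}$ and $b,d\in\overline{F}$ put $$\delta_w(b,d)=\frac{|b-d|_w}{\max\{|b|_w,1\}\max\{|d|_w,1\}}.$$ For $D\subseteq\overline{F}$, an element $\alpha\in F$ is called $S$-integral to $D$ if $\delta_w(\alpha,d)=1$ for every $d\in D$, every absolute value $v$ on $F$ representing a place outside $S$, and every absolute value $w$ on $\overline{F}$ extending $v$ (equivalently, for every embedding of $\overline{F}$ over $F$ into $\mathbb{C}_v$). Let $\varphi\in F(x)$ be a non-zero rational function whose numerator, in lowest terms, has $t>r$ irreducible factors $f_1,\dots,f_t\in F[x]$ which are pairwise distinct up to multiplication by constants. Let $D=\{\delta\in\overline{F} : \varphi(\delta)=0\}$ be the set of roots in $\overline{F}$ of the numerator of $\varphi$. Then there are only finitely many $\alpha\in F$ that are $S$-integral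 to $D$. -/

import Mathlib

open Polynomial

noncomputable section

/-- A global field: a finite extension of `ℚ` or of `𝔽_p(t)` for some prime `p`. -/
def IsGlobalField (F : Type*) [Field F] : Prop :=
  NumberField F ∨
    ∃ (p : ℕ) (_ : Fact p.Prime) (_ : Algebra (RatFunc (ZMod p)) F), FunctionField (ZMod p) F

/-- A place of `F`: an equivalence class of non-trivial real absolute values on `F`. -/
def Place (F : Type*) [Field F] : Type _ :=
  {P : Quotient (inferInstance : Setoid (AbsoluteValue F ℝ)) //
    ∃ v : AbsoluteValue F ℝ, v.IsNontrivial ∧ ⟦v⟧ = P}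

/-- The place of `F` defined by a non-trivial absolute value. -/
def Place.mk {F : Type*} [Field F] (v : AbsoluteValue F ℝ) (hv : v.IsNontrivial) : Place F :=
  ⟨⟦v⟧, v, hv, rfl⟩

theorem Place.mk_eq_mk_iff {F : Type*} [Field F] {v w : AbsoluteValue F ℝ}
    (hv : v.IsNontrivial) (hw : w.IsNontrivial) :
    Place.mk v hv = Place.mk w hw ↔ v.IsEquiv w :=
  Subtype.ext_iff.trans Quotient.eq

/-- The chordal distance of the points `[x₁ : y₁]` and `[x₂ : y₂]` of the projective line with
respect to the absolute value `w`, in homogeneous coordinates. -/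
def chordalDist {K : Type*} [Field K] (w : AbsoluteValue K ℝ) (x₁ y₁ x₂ y₂ : K) : ℝ :=
  w (x₁ * y₂ - x₂ * y₁) / (max (w x₁) (w y₁) * max (w x₂) (w y₂))

/-- The element `b` of `F` is `S`-integral to the set `D` of points of the algebraic closure of `F`:
for every place of `F` outside `S`, represented by an absolute value `v`, the chordal distance
between `b = [b : 1]` and `d = [d : 1]` is `1` for every `d ∈ D`, for every embedding of the
algebraic closure of `F` into `ℂ_v` over `F`. The absolute values on the algebraic closure which
these embeddings induce are exactly the extensions `w` of `v`. -/
def IsIntegralTo {F : Type*} [Field F] (S : Set (Place F)) (D : Set (AlgebraicClosure F))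
    (b : F) : Prop :=
  ∀ (v : AbsoluteValue F ℝ) (hv : v.IsNontrivial), Place.mk v hv ∉ S →
    ∀ w : AbsoluteValue (AlgebraicClosure F) ℝ, w.LiesOver v →
      ∀ d ∈ D, chordalDist w (algebraMap F (AlgebraicClosure F) b) 1 d 1 = 1

/-- The zeros in the algebraic closure of `F` of a rational function `φ ∈ F(x)`, that is, the roots
of its reduced numerator. -/
def zeroSet {F : Type*} [Field F] (φ : RatFunc F) : Set (AlgebraicClosure F) :=
  {δ | aeval δ φ.num = 0}

end

/-! ### Heights and global families of absolute values. -/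

noncomputable section

/-! Runge's method. Fix a family of absolute values on `F` with the product formula and the
Northcott property, and measure `f j` at `x` by `normalizedEval`, the size of its homogenization at
`[x : 1]`. If `x` is integral to the roots of `f j`, then outside `S` this size does not depend on
`x` (`normalizedEval_eq_of_chordalDist_eq_one`). The product of the sizes over the whole family is
`H(x) ^ (-deg (f j))`, so for large height every `f j` is small at some member of the family lying
in `S`. As `t > r`, two of the factors are small at the same place. Being coprime, they cannot both
be small there (`eventually_not_small_of_isEquiv`). Hence the height is bounded and Northcott gives
finiteness.

The family is built in three stages: on `ℚ` or `𝔽_p(T)` from the primes of a principal ideal domain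
and one place at infinity (`IsInftyAbsoluteValue.isGlobalFamily`); on the separable closure of that
field in `F`, through embeddings, norms and traces (`IsGlobalFamily.embeddingFamily`); on `F`, by
taking `q`-th powers (`IsGlobalFamily.of_forall_pow_mem`). An absolute value may recur in the
family, which accounts for local degrees. -/

/-- The multiplicative height of `x` with respect to a family of absolute values. -/
def familyHeight {F ι : Type*} [Field F] (u : ι → AbsoluteValue F ℝ) (x : F) : ℝ :=
  ∏ᶠ i, max (u i x) 1

/-- A family of non-trivial absolute values, finitely many in each class, which satisfies the
product formula and the Northcott property. -/
structure IsGlobalFamily {F ι : Type*} [Field F] (u : ι → AbsoluteValue F ℝ) : Prop where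
  isNontrivial : ∀ i, (u i).IsNontrivial
  finite_isEquiv : ∀ i, {j | (u j).IsEquiv (u i)}.Finite
  finite_mulSupport : ∀ x, x ≠ 0 → (fun i ↦ u i x).HasFiniteMulSupport
  finprod_eq_one : ∀ x, x ≠ 0 → ∏ᶠ i, u i x = 1
  northcott : ∀ B, {x | familyHeight u x ≤ B}.Finite

theorem one_le_finprod_of_one_le {ι : Type*} {f : ι → ℝ} (hf : ∀ i, 1 ≤ f i) :
    1 ≤ ∏ᶠ i, f i :=
  finprod_induction (1 ≤ ·) le_rfl (fun _ _ ↦ one_le_mul_of_one_le_of_one_le) hf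

theorem one_le_familyHeight {F ι : Type*} [Field F] (u : ι → AbsoluteValue F ℝ) (x : F) :
    1 ≤ familyHeight u x :=
  one_le_finprod_of_one_le fun _ ↦ le_max_right _ _

theorem finprod_le_finprod_of_one_le {ι : Type*} {f g : ι → ℝ} (hf : f.HasFiniteMulSupport)
    (hg : g.HasFiniteMulSupport) (h0 : ∀ i, 0 ≤ f i) (hfg : ∀ i, f i ≤ g i) :
    ∏ᶠ i, f i ≤ ∏ᶠ i, g i := by
  classical
  rw [finprod_eq_prod_of_mulSupport_toFinset_subset f hf
      (s := hf.toFinset ∪ hg.toFinset) Finset.subset_union_left,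
    finprod_eq_prod_of_mulSupport_toFinset_subset g hg
      (s := hf.toFinset ∪ hg.toFinset) Finset.subset_union_right]
  exact Finset.prod_le_prod (fun i _ ↦ h0 i) fun i _ ↦ hfg i

theorem hasFiniteMulSupport_max_one {F ι : Type*} [Field F] {u : ι → AbsoluteValue F ℝ}
    (hu : ∀ x, x ≠ 0 → (fun i ↦ u i x).HasFiniteMulSupport) (x : F) :
    (fun i ↦ max (u i x) 1).HasFiniteMulSupport := by
  by_cases hx : x = 0
  · simp [hx, Function.HasFiniteMulSupport, Function.mulSupport]
  · exact (hu x hx).subset fun i hi h ↦ hi (by simp [show u i x = 1 from h])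

/-! ### Lower bounds for polynomials at a single place. -/

section LocalBounds

variable {F : Type*} [Field F]

/-- The absolute value of the value of `f` at the point `[x : 1]`, in normalized coordinates. -/
def normalizedEval (u : AbsoluteValue F ℝ) (f : F[X]) (x : F) : ℝ :=
  u (f.eval x) / max (u x) 1 ^ f.natDegree

theorem normalizedEval_nonneg (u : AbsoluteValue F ℝ) (f : F[X]) (x : F) :
    0 ≤ normalizedEval u f x := by
  unfold normalizedEval; positivity

theorem normalizedEval_pos (u : AbsoluteValue F ℝ) {f : F[X]} {x : F} (h : f.eval x ≠ 0) :
    0 < normalizedEval u f x :=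
  div_pos (u.pos h) (by positivity)

theorem AbsoluteValue.exists_eval_le (u : AbsoluteValue F ℝ) (f : F[X]) (n : ℕ)
    (hn : f.natDegree ≤ n) : ∃ M > 0, ∀ x, u (f.eval x) ≤ M * max (u x) 1 ^ n := by
  refine ⟨(∑ k ∈ Finset.range (n + 1), u (f.coeff k)) + 1, by positivity, fun x ↦ ?_⟩
  rw [eval_eq_sum_range' (Nat.lt_succ_of_le hn), add_mul, Finset.sum_mul]
  refine (u.sum_le _ _).trans (le_add_of_le_of_nonneg (Finset.sum_le_sum fun k hk ↦ ?_)
    (by positivity))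
  rw [map_mul, map_pow]
  refine mul_le_mul_of_nonneg_left ?_ (u.nonneg _)
  exact (pow_le_pow_left₀ (u.nonneg _) (le_max_left _ _) k).trans
    (pow_le_pow_right₀ (le_max_right _ _) (by simpa [Nat.lt_succ_iff] using hk))

/-- Near infinity the leading term dominates: beyond `R` the remaining terms amount to less than
half of it. -/
theorem exists_le_normalizedEval_of_large (u : AbsoluteValue F ℝ) {f : F[X]}
    (hf : 0 < f.natDegree) :
    ∃ c > 0, ∃ R ≥ 1, ∀ x, R < u x → c ≤ normalizedEval u f x := by
  obtain ⟨M, hM, h⟩ := u.exists_eval_le f.eraseLead (f.natDegree - 1) (eraseLead_natDegree_le f)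
  have hf0 : f ≠ 0 := by rintro rfl; simp at hf
  have hlc : 0 < u f.leadingCoeff := u.pos (leadingCoeff_ne_zero.mpr hf0)
  refine ⟨u f.leadingCoeff / 2, by positivity, max 1 (2 * M / u f.leadingCoeff),
    le_max_left _ _, fun x hx ↦ ?_⟩
  obtain ⟨h1, h2⟩ := max_lt_iff.1 hx
  obtain ⟨n, hn⟩ : ∃ n, f.natDegree = n + 1 := ⟨f.natDegree - 1, by omega⟩
  have hx' := h x
  unfold normalizedEval
  rw [max_eq_left h1.le] at hx' ⊢
  rw [hn, Nat.add_sub_cancel] at hx'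
  rw [le_div_iff₀ (by positivity)]
  have key : u (f.leadingCoeff * x ^ f.natDegree) ≤ u (f.eval x) + u (f.eraseLead.eval x) := by
    have : f.leadingCoeff * x ^ f.natDegree = f.eval x - f.eraseLead.eval x := by
      have := congrArg (eval x) (eraseLead_add_monomial_natDegree_leadingCoeff f)
      rw [eval_add, eval_monomial] at this
      rw [← this, add_sub_cancel_left]
    rw [this]
    exact u.sub_le_add _ _
  rw [map_mul, map_pow, hn, pow_succ] at key
  rw [hn, pow_succ]
  rw [div_lt_iff₀ hlc] at h2
  have hp : 0 < u x ^ n := by positivity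
  nlinarith [mul_lt_mul_of_pos_left h2 hp]

/-- Coprime polynomials cannot both be small at the same point. -/
theorem exists_le_max_normalizedEval (u : AbsoluteValue F ℝ) {f g : F[X]}
    (hf : 0 < f.natDegree) (hfg : IsCoprime f g) :
    ∃ c > 0, ∀ x, c ≤ max (normalizedEval u f x) (normalizedEval u g x) := by
  obtain ⟨c, hc, R, hR, hlarge⟩ := exists_le_normalizedEval_of_large u hf
  obtain ⟨a, b, hab⟩ := hfg
  obtain ⟨A, hA, hA'⟩ := u.exists_eval_le a _ le_rfl
  obtain ⟨B, hB, hB'⟩ := u.exists_eval_le b _ le_rfl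
  set N := a.natDegree + b.natDegree + f.natDegree + g.natDegree with hN
  have hR0 : 0 < R := by linarith
  -- On the disc `u x ≤ R`, the Bézout relation `a * f + b * g = 1` gives `1 ≤ (A + B) * R ^ N * R ^
  -- N * m`, where `m` is the larger of the two normalized values.
  set δ := ((A + B) * R ^ N * R ^ N)⁻¹ with hδ
  have hδ0 : 0 < δ := by positivity
  refine ⟨min c δ, lt_min hc hδ0, fun x ↦ ?_⟩
  by_cases hx : R < u x
  · exact (min_le_left _ _).trans ((hlarge x hx).trans (le_max_left _ _))
  refine (min_le_right _ _).trans ?_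
  push Not at hx
  have hmx : max (u x) 1 ≤ R := max_le hx hR
  have hpow : ∀ n ≤ N, max (u x) 1 ^ n ≤ R ^ N := fun n hn ↦
    (pow_le_pow_left₀ (by positivity) hmx n).trans (pow_le_pow_right₀ hR hn)
  have hbd : ∀ p : F[X], p.natDegree ≤ N → u (p.eval x) ≤ normalizedEval u p x * R ^ N := by
    intro p hp
    calc u (p.eval x) = normalizedEval u p x * max (u x) 1 ^ p.natDegree := by
          unfold normalizedEval; field_simp
      _ ≤ _ := mul_le_mul_of_nonneg_left (hpow _ hp) (normalizedEval_nonneg _ _ _)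
  set m := max (normalizedEval u f x) (normalizedEval u g x) with hm
  have hm0 : 0 ≤ m := (normalizedEval_nonneg u f x).trans (le_max_left _ _)
  have hRN : 0 < R ^ N := by positivity
  have h1 : (1 : ℝ) ≤ u (a.eval x) * u (f.eval x) + u (b.eval x) * u (g.eval x) := by
    rw [← map_mul, ← map_mul]
    refine le_trans (le_of_eq ?_) (u.add_le _ _)
    rw [← eval_mul, ← eval_mul, ← eval_add, hab, eval_one, map_one]
  have h2 : u (a.eval x) * u (f.eval x) ≤ (A * R ^ N) * (m * R ^ N) := by
    refine mul_le_mul ((hA' x).trans ?_) ((hbd f (by omega)).trans ?_) (u.nonneg _) (by positivity)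
    · exact mul_le_mul_of_nonneg_left (hpow _ (by omega)) hA.le
    · exact mul_le_mul_of_nonneg_right (le_max_left _ _) hRN.le
  have h3 : u (b.eval x) * u (g.eval x) ≤ (B * R ^ N) * (m * R ^ N) := by
    refine mul_le_mul ((hB' x).trans ?_) ((hbd g (by omega)).trans ?_) (u.nonneg _) (by positivity)
    · exact mul_le_mul_of_nonneg_left (hpow _ (by omega)) hB.le
    · exact mul_le_mul_of_nonneg_right (le_max_right _ _) hRN.le
  rw [hδ, inv_le_iff_one_le_mul₀ (by positivity)]
  linarith

/-- Equivalent absolute values are powers of each other, and normalization commutes with powers, so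
one absolute value suffices. Two are allowed because several members of a family may represent the
same place. -/
theorem eventually_not_small_of_isEquiv {u v : AbsoluteValue F ℝ} (huv : u.IsEquiv v) {f g : F[X]}
    (hf : 0 < f.natDegree) (hfg : IsCoprime f g) :
    ∀ᶠ ε in nhdsWithin (0 : ℝ) (Set.Ioi 0), ∀ x,
      ¬ (normalizedEval u f x < ε ∧ normalizedEval v g x < ε) := by
  obtain ⟨c, hc, hcu⟩ := AbsoluteValue.isEquiv_iff_exists_rpow_eq.1 huv
  obtain ⟨δ, hδ, h⟩ := exists_le_max_normalizedEval u hf hfg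
  have hm : Set.Ioo (0 : ℝ) (min δ (δ ^ c)) ∈ nhdsWithin (0 : ℝ) (Set.Ioi 0) :=
    Ioo_mem_nhdsGT (lt_min hδ (by positivity))
  filter_upwards [hm] with ε hε x ⟨h1, h2⟩
  obtain ⟨h3, h4⟩ := lt_min_iff.1 hε.2
  have hv : normalizedEval v g x = normalizedEval u g x ^ c := by
    unfold normalizedEval
    have hvu (y : F) : v y = u y ^ c := (congrFun hcu y).symm
    rw [Real.div_rpow (u.nonneg _) (by positivity), hvu, hvu, ← Real.rpow_natCast,
      ← Real.rpow_natCast, ← Real.rpow_mul (by positivity), mul_comm _ c,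
      Real.rpow_mul (by positivity)]
    congr 2
    have hmono : MonotoneOn (fun y : ℝ ↦ y ^ c) (Set.Ici 0) :=
      fun a ha b _ hab ↦ Real.rpow_le_rpow ha hab hc.le
    have := hmono.map_max (a := u x) (b := 1) (u.nonneg x)
      (Set.mem_Ici.2 zero_le_one)
    simpa using this.symm
  rw [hv] at h2
  refine (h x).not_gt (max_lt (h1.trans h3) ?_)
  by_contra hcon
  push Not at hcon
  exact absurd (Real.rpow_le_rpow hδ.le hcon hc.le) (not_le.2 (h2.trans h4))

end LocalBounds

/-! ### Runge's argument. -/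

section Runge

variable {F : Type*} [Field F]

theorem apply_sub_of_chordalDist_eq_one {K : Type*} [Field K] (w : AbsoluteValue K ℝ) {x y : K}
    (h : chordalDist w x 1 y 1 = 1) : w (x - y) = max (w x) 1 * max (w y) 1 := by
  have h0 : 0 < max (w x) 1 * max (w y) 1 := by positivity
  rw [chordalDist, div_eq_one_iff_eq (by simp only [map_one]; exact h0.ne')] at h
  simpa using h

/-- Over the algebraic closure `f` is a product of factors `x - d`, and integrality makes each of
size `max (w x) 1 * max (w d) 1`. The powers of `max (w x) 1` cancel, so the value is independent of
`x`. -/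
theorem normalizedEval_eq_of_chordalDist_eq_one {u : AbsoluteValue F ℝ}
    (w : AbsoluteValue (AlgebraicClosure F) ℝ) (hw : w.LiesOver u) {f : F[X]} {x : F}
    (h : ∀ d : AlgebraicClosure F, aeval d f = 0 →
      chordalDist w (algebraMap F (AlgebraicClosure F) x) 1 d 1 = 1) :
    normalizedEval u f x = w (algebraMap F _ f.leadingCoeff) *
      ((f.aroots (AlgebraicClosure F)).map fun d ↦ max (w d) 1).prod := by
  have hwu (y : F) : u y = w (algebraMap F _ y) := by
    rw [← AbsoluteValue.LiesOver.comp_eq w u]; rfl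
  have hsp : (f.map (algebraMap F (AlgebraicClosure F))).Splits := IsAlgClosed.splits _
  have hcard : (f.aroots (AlgebraicClosure F)).card = f.natDegree := by
    rw [aroots, ← hsp.natDegree_eq_card_roots, natDegree_map]
  unfold normalizedEval
  rw [div_eq_iff (by positivity), hwu, hwu, ← eval₂_at_apply, ← eval_map,
    hsp.eval_eq_prod_roots, leadingCoeff_map, map_mul, map_multiset_prod, Multiset.map_map,
    mul_assoc]
  congr 1
  rw [← hcard, ← Multiset.prod_replicate, ← Multiset.map_const', ← Multiset.prod_map_mul]
  congr 1
  refine Multiset.map_congr rfl fun d hd ↦ ?_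
  rw [mul_comm]
  exact apply_sub_of_chordalDist_eq_one w (h d ((mem_aroots.1 hd).2))

theorem finprod_normalizedEval {ι : Type*} {u : ι → AbsoluteValue F ℝ} (hu : IsGlobalFamily u)
    {f : F[X]} {x : F} (h : f.eval x ≠ 0) :
    (fun i ↦ normalizedEval (u i) f x).HasFiniteMulSupport ∧
      (∏ᶠ i, normalizedEval (u i) f x) * familyHeight u x ^ f.natDegree = 1 := by
  have h1 := hu.finite_mulSupport _ h
  have h2 := hasFiniteMulSupport_max_one hu.finite_mulSupport x
  have h3 : (fun i ↦ max (u i x) 1 ^ f.natDegree).HasFiniteMulSupport := h2.pow f.natDegree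
  refine ⟨h1.div h3, ?_⟩
  unfold normalizedEval familyHeight
  rw [finprod_div_distrib h1 h3, hu.finprod_eq_one _ h, finprod_pow h2, one_div,
    inv_mul_cancel₀]
  exact finprod_ne_zero fun i ↦ (by positivity)

/-- **Runge's theorem** over a field with a family of absolute values that satisfies the product
formula and the Northcott property. -/
theorem finite_setOf_isIntegralTo {ι : Type*} {u : ι → AbsoluteValue F ℝ} (hu : IsGlobalFamily u)
    (hext : ∀ i, ∃ w : AbsoluteValue (AlgebraicClosure F) ℝ, w.LiesOver (u i))
    (S : Finset (Place F)) (φ : RatFunc F) (t : ℕ) (ht : S.card < t) (f : Fin t → F[X])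
    (hirr : ∀ i, Irreducible (f i)) (hdist : ∀ i j, i ≠ j → ¬ Associated (f i) (f j))
    (hdvd : ∀ i, f i ∣ φ.num) :
    {α : F | IsIntegralTo (S : Set (Place F)) (zeroSet φ) α}.Finite := by
  classical
  choose w hw using hext
  have hcop : ∀ i j, i ≠ j → IsCoprime (f i) (f j) := fun i j hij ↦
    (hirr i).coprime_iff_not_dvd.2 fun h ↦ hdist i j hij ((hirr i).associated_of_dvd (hirr j) h)
  have hdeg : ∀ j, 0 < (f j).natDegree := fun j ↦ (hirr j).natDegree_pos
  let pl : ι → Place F := fun i ↦ Place.mk (u i) (hu.isNontrivial i)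
  let S' : Set ι := {i | pl i ∈ S}
  have hS' : S'.Finite := by
    refine Set.Finite.preimage' S.finite_toSet fun P _ ↦ ?_
    by_cases h : ∃ i, pl i = P
    · obtain ⟨i, rfl⟩ := h
      refine (hu.finite_isEquiv i).subset fun j hj ↦ ?_
      exact (Place.mk_eq_mk_iff _ _).1 hj
    · convert Set.finite_empty
      exact Set.eq_empty_of_forall_notMem fun i hi ↦ h ⟨i, hi⟩
  -- Roots of the `f j` in `F` are set aside, since the product formula needs a non-zero value.
  let Z : Set F := ⋃ j, {x | (f j).IsRoot x}
  have hZ : Z.Finite := Set.finite_iUnion fun j ↦ finite_setOfPred_isRoot (hirr j).ne_zero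
  let T : Set F := {α | IsIntegralTo (S : Set (Place F)) (zeroSet φ) α} \ Z
  suffices hT : T.Finite from (hT.union hZ).subset fun x hx ↦ by
    by_cases hxZ : x ∈ Z
    · exact Or.inr hxZ
    · exact Or.inl ⟨hx, hxZ⟩
  have hne : ∀ x ∈ T, ∀ j, (f j).eval x ≠ 0 := fun x hx j h ↦ hx.2 (Set.mem_iUnion.2 ⟨j, h⟩)
  rcases T.eq_empty_or_nonempty with hTe | ⟨x₀, hx₀⟩
  · rw [hTe]; exact Set.finite_empty
  have hconst : ∀ x ∈ T, ∀ j, ∀ i ∉ S',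
      normalizedEval (u i) (f j) x = normalizedEval (u i) (f j) x₀ := by
    intro x hx j i hi
    have key : ∀ y ∈ T, ∀ d : AlgebraicClosure F, aeval d (f j) = 0 →
        chordalDist (w i) (algebraMap F (AlgebraicClosure F) y) 1 d 1 = 1 := by
      intro y hy d hd
      refine hy.1 (u i) (hu.isNontrivial i) hi (w i) (hw i) d ?_
      obtain ⟨g, hg⟩ := hdvd j
      simp [zeroSet, hg, hd]
    rw [normalizedEval_eq_of_chordalDist_eq_one (w i) (hw i) (key x hx),
      normalizedEval_eq_of_chordalDist_eq_one (w i) (hw i) (key x₀ hx₀)]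
  have hε : ∀ᶠ ε in nhdsWithin (0 : ℝ) (Set.Ioi 0), ∀ j j' : Fin t, ∀ i ∈ S', ∀ i' ∈ S',
      j ≠ j' → (u i).IsEquiv (u i') → ∀ x,
        ¬ (normalizedEval (u i) (f j) x < ε ∧ normalizedEval (u i') (f j') x < ε) := by
    refine Filter.eventually_all.2 fun j ↦ Filter.eventually_all.2 fun j' ↦
      (Filter.eventually_all_finite hS').2 fun i _ ↦ (Filter.eventually_all_finite hS').2
        fun i' _ ↦ ?_
    by_cases hj : j = j'
    · exact Filter.Eventually.of_forall fun ε h ↦ absurd hj h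
    by_cases hi : (u i).IsEquiv (u i')
    · filter_upwards [eventually_not_small_of_isEquiv hi (hdeg j) (hcop j j' hj)] with ε h _ _
      exact h
    · exact Filter.Eventually.of_forall fun ε _ h ↦ absurd h hi
  obtain ⟨ε, hε, hε0⟩ := (hε.and self_mem_nhdsWithin).exists
  replace hε0 : 0 < ε := hε0
  -- The contribution from outside `S`, computed at the base point `x₀`; by `hconst` it is the same
  -- at every point of `T`.
  let κ : Fin t → ℝ := fun j ↦ ∏ᶠ i ∈ S'ᶜ, normalizedEval (u i) (f j) x₀
  have hκ : ∀ j, 0 < κ j := fun j ↦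
    finprod_mem_induction (0 < ·) one_pos (fun _ _ ↦ mul_pos)
      fun i _ ↦ normalizedEval_pos _ (hne x₀ hx₀ j)
  -- If all values of `f j` at the members in `S` were at least `ε`, the height would be at most the
  -- `j`-th summand; the sum covers all `j` at once.
  refine (hu.northcott (∑ j, (ε ^ hS'.toFinset.card * κ j)⁻¹)).subset fun x hx ↦ ?_
  by_contra hbig
  replace hbig : ∑ j, (ε ^ hS'.toFinset.card * κ j)⁻¹ < familyHeight u x := not_le.1 hbig
  have hsmall : ∀ j, ∃ i ∈ S', normalizedEval (u i) (f j) x < ε := by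
    intro j
    by_contra! hcon
    obtain ⟨hfin, hprod⟩ := finprod_normalizedEval hu (hne x hx j)
    have hsplit : (∏ i ∈ hS'.toFinset, normalizedEval (u i) (f j) x) * κ j =
        ∏ᶠ i, normalizedEval (u i) (f j) x := by
      rw [← finprod_mem_univ, ← Set.union_compl_self S',
        finprod_mem_union' disjoint_compl_right (hS'.inter_of_left _) (hfin.inter_of_right _),
        finprod_mem_eq_finite_toFinset_prod _ hS']
      congr 1
      exact finprod_mem_congr rfl fun i hi ↦ (hconst x hx j i hi).symm
    have hge : ε ^ hS'.toFinset.card ≤ ∏ i ∈ hS'.toFinset, normalizedEval (u i) (f j) x := by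
      rw [← Finset.prod_const]
      exact Finset.prod_le_prod (fun _ _ ↦ hε0.le) fun i hi ↦ hcon i (hS'.mem_toFinset.1 hi)
    have hH := one_le_familyHeight u x
    have h1 : familyHeight u x ≤ familyHeight u x ^ (f j).natDegree :=
      le_self_pow₀ hH (hdeg j).ne'
    have hpos : 0 < ε ^ hS'.toFinset.card * κ j := mul_pos (pow_pos hε0 _) (hκ j)
    have h2 : familyHeight u x ≤ (ε ^ hS'.toFinset.card * κ j)⁻¹ := by
      rw [le_inv_comm₀ (by linarith) hpos, ← one_div, le_div_iff₀ (by linarith), ← hprod,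
        ← hsplit]
      exact mul_le_mul (mul_le_mul_of_nonneg_right hge (hκ j).le) h1 (by linarith)
        (mul_nonneg (Finset.prod_nonneg fun _ _ ↦ normalizedEval_nonneg _ _ _) (hκ j).le)
    have h3 : (ε ^ hS'.toFinset.card * κ j)⁻¹ ≤ ∑ j, (ε ^ hS'.toFinset.card * κ j)⁻¹ :=
      Finset.single_le_sum (f := fun j ↦ (ε ^ hS'.toFinset.card * κ j)⁻¹)
        (fun j _ ↦ (inv_pos.2 (mul_pos (pow_pos hε0 _) (hκ j))).le) (Finset.mem_univ j)
    linarith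
  choose i hiS hi using hsmall
  -- The pigeonhole is on places rather than on indices: only `S.card`, not the size of `S'`, is
  -- less than `t`.
  obtain ⟨j, -, j', -, hjj, hpl⟩ := Finset.exists_ne_map_eq_of_card_lt_of_maps_to
    (s := (Finset.univ : Finset (Fin t))) (t := S) (by simpa using ht) (f := fun j ↦ pl (i j))
    fun j _ ↦ hiS j
  exact hε j j' (i j) (hiS j) (i j') (hiS j') hjj ((Place.mk_eq_mk_iff _ _).1 hpl) x
    ⟨hi j, hi j'⟩

end Runge

/-! ### Extension of nonarchimedean absolute values. -/

/-- A non-trivial nonarchimedean absolute value extends to every algebraic extension. -/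
theorem exists_isNonarchimedean_extension {K L : Type*} [Field K] [Field L]
    [Algebra K L] [Algebra.IsAlgebraic K L] (v : AbsoluteValue K ℝ) (hv : v.IsNontrivial)
    (hna : IsNonarchimedean v) :
    ∃ w : AbsoluteValue L ℝ, IsNonarchimedean w ∧ ∀ x, w (algebraMap K L x) = v x := by
  have hnorm (x : WithAbs v) : ‖x‖ = v x.ofAbs := rfl
  have hud : IsUltrametricDist v.Completion := by
    refine IsUltrametricDist.isUltrametricDist_of_forall_norm_natCast_le_one fun n ↦ ?_
    rw [← map_natCast (UniformSpace.Completion.coeRingHom (α := WithAbs v))]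
    refine (UniformSpace.Completion.norm_coe (n : WithAbs v)).trans_le ?_
    rw [hnorm, ← WithAbs.equiv_apply, map_natCast]
    exact hna.apply_natCast_le_one
  let _ : NontriviallyNormedField v.Completion :=
    { (inferInstance : NormedField v.Completion) with
      non_trivial := by
        obtain ⟨x, hx⟩ := hv.exists_abv_gt_one
        refine ⟨(WithAbs.toAbs v x : v.Completion), ?_⟩
        exact hx.trans_eq (UniformSpace.Completion.norm_coe (WithAbs.toAbs v x)).symm }
  -- The spectral norm extends the norm of the completion to `C`; its pullback along a `K`-embedding
  -- of `L` is the required extension.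
  let C := AlgebraicClosure v.Completion
  let g : K →+* v.Completion := (UniformSpace.Completion.coeRingHom (α := WithAbs v)).comp
    (WithAbs.equiv v).symm.toRingHom
  let _ : Algebra K C := ((algebraMap v.Completion C).comp g).toAlgebra
  let s : L →ₐ[K] C := IsAlgClosed.lift
  let _ := spectralNorm.normedField v.Completion C
  have hnormC (y : C) : ‖y‖ = spectralNorm v.Completion C y := rfl
  refine ⟨(NormedField.toAbsoluteValue C).comp (f := s.toRingHom) s.toRingHom.injective, ?_,
    fun x ↦ ?_⟩
  · intro x y
    change ‖s (x + y)‖ ≤ max ‖s x‖ ‖s y‖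
    rw [map_add, hnormC, hnormC, hnormC]
    exact isNonarchimedean_spectralNorm _ _
  · change ‖s (algebraMap K L x)‖ = v x
    rw [s.commutes, hnormC]
    exact (spectralNorm_extends (g x)).trans
      (UniformSpace.Completion.norm_coe (WithAbs.toAbs v x))

/-! ### Global families on fraction fields of principal ideal domains. -/

section BaseField

open IsDedekindDomain

variable {A K : Type*} [CommRing A] [IsPrincipalIdealRing A] [Field K] [Algebra A K]

theorem intAdicAbv_of_asIdeal_eq {A : Type*} [CommRing A] [IsDedekindDomain A]
    {P : HeightOneSpectrum A} {b : NNReal} (hb : 1 < b) {x : A} (hx0 : x ≠ 0)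
    (hx : P.asIdeal = Ideal.span {x}) : P.intAdicAbv hb x = (b : ℝ)⁻¹ := by
  change ((P.intAdicAbvDef hb x : NNReal) : ℝ) = _
  simp only [HeightOneSpectrum.intAdicAbvDef]
  rw [P.intValuation_singleton hx0 hx, WithZeroMulInt.toNNReal_neg_apply _ WithZero.exp_ne_zero]
  exact zpow_neg_one (b : ℝ)

/-- An absolute value on the fraction field of a principal ideal domain which behaves like the
place at infinity of `ℚ` or of a rational function field over a finite field. -/
structure IsInftyAbsoluteValue (A : Type*) {K : Type*} [CommRing A] [Field K] [Algebra A K]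
    (a : AbsoluteValue K ℝ) : Prop where
  isNontrivial : a.IsNontrivial
  isUnit : ∀ x : A, IsUnit x → a (algebraMap A K x) = 1
  one_lt : ∀ x : A, x ≠ 0 → ¬ IsUnit x → 1 < a (algebraMap A K x)
  finite_le : ∀ B, {x : A | a (algebraMap A K x) ≤ B}.Finite

variable {a : AbsoluteValue K ℝ}

namespace IsInftyAbsoluteValue

theorem one_lt_generator (ha : IsInftyAbsoluteValue A a) (P : HeightOneSpectrum A) :
    1 < a (algebraMap A K (Submodule.IsPrincipal.generator P.asIdeal)) := by
  refine ha.one_lt _ (fun h ↦ P.ne_bot ?_) fun h ↦ P.isPrime.ne_top ?_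
  · exact (Submodule.IsPrincipal.eq_bot_iff_generator_eq_zero _).2 h
  · rw [← Ideal.span_singleton_generator P.asIdeal]
    exact Ideal.span_singleton_eq_top.2 h

variable [IsDomain A] [IsFractionRing A K]

/-- The family of absolute values formed by `a` and the normalized `P`-adic absolute values. -/
def family (ha : IsInftyAbsoluteValue A a) : Option (HeightOneSpectrum A) → AbsoluteValue K ℝ
  | none => a
  | some P => P.adicAbv (Real.one_lt_toNNReal.2 (ha.one_lt_generator P))

variable (ha : IsInftyAbsoluteValue A a)

theorem family_none : ha.family none = a := rfl

theorem family_some_eq_one_iff (P : HeightOneSpectrum A) (x : A) :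
    ha.family (some P) (algebraMap A K x) = 1 ↔ x ∉ P.asIdeal :=
  P.adicAbv_coe_eq_one_iff _ _

theorem family_some_lt_one_iff (P : HeightOneSpectrum A) (x : A) :
    ha.family (some P) (algebraMap A K x) < 1 ↔ x ∈ P.asIdeal :=
  P.adicAbv_coe_lt_one_iff _ _

theorem family_some_le_one (P : HeightOneSpectrum A) (x : A) :
    ha.family (some P) (algebraMap A K x) ≤ 1 :=
  P.adicAbv_coe_le_one _ _

theorem isNonarchimedean_family_some (P : HeightOneSpectrum A) :
    IsNonarchimedean (ha.family (some P)) :=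
  P.isNonarchimedean_adicAbv _

theorem isNontrivial_family (i : Option (HeightOneSpectrum A)) : (ha.family i).IsNontrivial := by
  cases i with
  | none => exact ha.isNontrivial
  | some P =>
    obtain ⟨x, hx, hx0⟩ := Submodule.exists_mem_ne_zero_of_ne_bot P.ne_bot
    exact ⟨algebraMap A K x, by simpa using hx0, ((ha.family_some_lt_one_iff P x).2 hx).ne⟩

theorem eq_of_isEquiv_family {i j : Option (HeightOneSpectrum A)}
    (h : (ha.family i).IsEquiv (ha.family j)) : i = j := by
  have key (P : HeightOneSpectrum A) : ¬ (ha.family none).IsEquiv (ha.family (some P)) :=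
    fun hP ↦ (ha.one_lt_generator P).not_gt (hP.lt_one_iff.2
      ((ha.family_some_lt_one_iff P _).2 (Submodule.IsPrincipal.generator_mem _)))
  match i, j with
  | none, none => rfl
  | none, some P => exact (key P h).elim
  | some P, none => exact (key P h.symm).elim
  | some P, some Q =>
    congr 1
    ext x
    rw [← ha.family_some_lt_one_iff, ← ha.family_some_lt_one_iff, h.lt_one_iff]

/-- The base of the `P`-adic absolute value was chosen for this: a prime element contributes
reciprocal factors at `P` and at infinity. -/
theorem family_apply_generator (P : HeightOneSpectrum A) {x : A} (hx : P.asIdeal = Ideal.span {x}) :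
    ha.family (some P) (algebraMap A K x) = (a (algebraMap A K x))⁻¹ := by
  have hx0 : x ≠ 0 := by
    rintro rfl
    exact P.ne_bot (by simp [hx])
  have h1 : a (algebraMap A K (Submodule.IsPrincipal.generator P.asIdeal)) =
      a (algebraMap A K x) := by
    have : Associated (Submodule.IsPrincipal.generator P.asIdeal) x := by
      rw [← Ideal.span_singleton_eq_span_singleton, Ideal.span_singleton_generator, hx]
    obtain ⟨y, rfl⟩ := this
    rw [map_mul, map_mul, ha.isUnit y y.isUnit, mul_one]
  rw [← h1]
  refine (P.adicAbv_of_algebraMap _ x).trans ((intAdicAbv_of_asIdeal_eq _ hx0 hx).trans ?_)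
  rw [Real.coe_toNNReal _ (a.nonneg _)]

/-- By multiplicativity it suffices to treat units, which have size `1` everywhere, and primes `p`,
which matter only at infinity and at `(p)`. -/
theorem hasFiniteMulSupport_and_finprod_of_algebraMap (x : A) (hx : x ≠ 0) :
    (fun i ↦ ha.family i (algebraMap A K x)).HasFiniteMulSupport ∧
      ∏ᶠ i, ha.family i (algebraMap A K x) = 1 := by
  classical
  induction x using UniqueFactorizationMonoid.induction_on_prime with
  | h₁ => exact absurd rfl hx
  | h₂ x hu =>
    have h (i) : ha.family i (algebraMap A K x) = 1 := by
      cases i with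
      | none => exact ha.isUnit x hu
      | some P =>
        exact (ha.family_some_eq_one_iff P x).2 fun h ↦ P.isPrime.ne_top
          (Ideal.eq_top_of_isUnit_mem _ h hu)
    simp [h, Function.HasFiniteMulSupport, Function.mulSupport]
  | h₃ y p hy0 hp ih =>
    obtain ⟨h1, h2⟩ := ih hy0
    let P₀ : HeightOneSpectrum A := ⟨Ideal.span {p}, (Ideal.span_singleton_prime hp.ne_zero).2 hp,
      by simpa using hp.ne_zero⟩
    have hsub : Function.mulSupport (fun i ↦ ha.family i (algebraMap A K p)) ⊆
        (({none, some P₀} : Finset (Option (HeightOneSpectrum A))) : Set _) := by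
      intro i hi
      cases i with
      | none => simp
      | some P =>
        have hpP : p ∈ P.asIdeal := not_not.1 fun h ↦ hi ((ha.family_some_eq_one_iff P p).2 h)
        have : P₀ = P := HeightOneSpectrum.ext <| P₀.isMaximal.eq_of_le P.isPrime.ne_top
          ((Ideal.span_singleton_le_iff_mem _).2 hpP)
        simp [this]
    have h3 : (fun i ↦ ha.family i (algebraMap A K p)).HasFiniteMulSupport :=
      (Finset.finite_toSet _).subset hsub
    have h4 : ∏ᶠ i, ha.family i (algebraMap A K p) = 1 := by
      rw [finprod_eq_prod_of_mulSupport_subset _ hsub, Finset.prod_pair (by simp),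
        ha.family_apply_generator P₀ rfl, family_none, mul_inv_cancel₀]
      exact a.ne_zero (by simpa using hp.ne_zero)
    simp only [map_mul]
    exact ⟨h3.mul h1, by rw [finprod_mul_distrib h3 h1, h2, h4, mul_one]⟩

theorem hasFiniteMulSupport_and_finprod (x : K) (hx : x ≠ 0) :
    (fun i ↦ ha.family i x).HasFiniteMulSupport ∧ ∏ᶠ i, ha.family i x = 1 := by
  obtain ⟨r, s, hs, rfl⟩ := IsFractionRing.div_surjective (A := A) x
  have hr : r ≠ 0 := by rintro rfl; simp at hx
  obtain ⟨h1, h2⟩ := ha.hasFiniteMulSupport_and_finprod_of_algebraMap r hr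
  obtain ⟨h3, h4⟩ := ha.hasFiniteMulSupport_and_finprod_of_algebraMap s (nonZeroDivisors.ne_zero hs)
  simp only [map_div₀]
  exact ⟨h1.div h3, by rw [finprod_div_distrib h1 h3, h2, h4, div_one]⟩

/-- Multiplying by the product formula for `s` turns each factor into `max |r| |s|`, which is `1` at
every prime because no prime divides both `r` and `s`. -/
theorem familyHeight_div {r s : A} (hs : s ≠ 0) (hrs : IsRelPrime r s) :
    familyHeight ha.family (algebraMap A K r / algebraMap A K s) =
      max (a (algebraMap A K r)) (a (algebraMap A K s)) := by
  obtain ⟨h1, h2⟩ := ha.hasFiniteMulSupport_and_finprod_of_algebraMap s hs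
  have hsK : algebraMap A K s ≠ 0 := by simpa using hs
  rw [← mul_one (familyHeight _ _), ← h2, familyHeight, ← finprod_mul_distrib
    (hasFiniteMulSupport_max_one (fun x hx ↦ (ha.hasFiniteMulSupport_and_finprod x hx).1) _) h1]
  have h (i) : max (ha.family i (algebraMap A K r / algebraMap A K s)) 1 *
      ha.family i (algebraMap A K s) =
        max (ha.family i (algebraMap A K r)) (ha.family i (algebraMap A K s)) := by
    rw [max_mul_of_nonneg _ _ ((ha.family i).nonneg _), one_mul, ← map_mul, div_mul_cancel₀ _ hsK]
  simp only [h]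
  rw [finprod_eq_single _ none fun i hi ↦ ?_, family_none]
  cases i with
  | none => exact absurd rfl hi
  | some P =>
    by_cases hr : r ∈ P.asIdeal
    · have hsP : s ∉ P.asIdeal := by
        intro hsP
        rw [← Ideal.span_singleton_generator P.asIdeal, Ideal.mem_span_singleton] at hr hsP
        have hu := hrs hr hsP
        exact P.isPrime.ne_top (Ideal.eq_top_of_isUnit_mem _
          (Submodule.IsPrincipal.generator_mem _) hu)
      rw [(ha.family_some_eq_one_iff P s).2 hsP, max_eq_right (ha.family_some_le_one P r)]
    · rw [(ha.family_some_eq_one_iff P r).2 hr, max_eq_left (ha.family_some_le_one P s)]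

theorem isGlobalFamily : IsGlobalFamily ha.family where
  isNontrivial := ha.isNontrivial_family
  finite_isEquiv i := (Set.finite_singleton i).subset fun _ h ↦ ha.eq_of_isEquiv_family h
  finite_mulSupport x hx := (ha.hasFiniteMulSupport_and_finprod x hx).1
  finprod_eq_one x hx := (ha.hasFiniteMulSupport_and_finprod x hx).2
  northcott B := by
    refine (((ha.finite_le B).prod (ha.finite_le B)).image
      fun y ↦ algebraMap A K y.1 / algebraMap A K y.2).subset fun x hx ↦ ?_
    obtain ⟨r, s, hrs, rfl⟩ := IsFractionRing.exists_reduced_fraction (A := A) x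
    rw [IsFractionRing.mk'_eq_div] at hx ⊢
    rw [Set.mem_ofPred_eq, ha.familyHeight_div (nonZeroDivisors.ne_zero s.2) hrs, max_le_iff] at hx
    exact ⟨(r, s), hx, rfl⟩

end IsInftyAbsoluteValue

end BaseField

theorem one_le_prod_of_one_le {ι : Type*} {s : Finset ι} {f : ι → ℝ} (hf : ∀ i ∈ s, 1 ≤ f i) :
    1 ≤ ∏ i ∈ s, f i :=
  Finset.prod_induction f (1 ≤ ·) (fun _ _ ↦ one_le_mul_of_one_le_of_one_le) le_rfl hf

/-! ### Global families on finite separable extensions. -/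

section Extension

/-- If `w y > 1`, the leading term strictly exceeds every lower one, which the ultrametric
inequality forbids. -/
theorem IsNonarchimedean.apply_le_one_of_monic {K Ω : Type*} [Field K] [Field Ω] [Algebra K Ω]
    {w : AbsoluteValue Ω ℝ} (hw : IsNonarchimedean w) {p : K[X]} (hp : p.Monic) {y : Ω}
    (hy : aeval y p = 0) (hc : ∀ k, w (algebraMap K Ω (p.coeff k)) ≤ 1) : w y ≤ 1 := by
  by_contra! h1
  rw [hp.as_sum, map_add, map_pow, aeval_X, add_eq_zero_iff_eq_neg] at hy
  have h2 := congrArg w hy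
  rw [w.map_neg, map_pow, map_sum] at h2
  have hn : 0 < p.natDegree := by
    rcases Nat.eq_zero_or_pos p.natDegree with h0 | h0
    · simp [h0] at h2
    · exact h0
  obtain ⟨k, hk, hle⟩ := hw.finset_image_add_of_nonempty
    (fun k ↦ aeval y (C (p.coeff k) * X ^ k)) (t := Finset.range p.natDegree) ⟨0, by simpa using hn⟩
  rw [← h2, map_mul, aeval_C, map_pow, aeval_X, map_mul, map_pow] at hle
  have h3 : w y ^ p.natDegree ≤ w y ^ k :=
    hle.trans (mul_le_of_le_one_left (by positivity) (hc k))
  exact absurd h3 (not_le.2 (pow_lt_pow_right₀ h1 (Finset.mem_range.1 hk)))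

variable {K E Ω V : Type*} [Field K] [Field E] [Field Ω] [Algebra K E] [Algebra K Ω]
  {v : V → AbsoluteValue K ℝ} {w : V → AbsoluteValue Ω ℝ}

theorem finite_setOf_one_lt_of_isAlgebraic (hv : ∀ x, x ≠ 0 → (fun i ↦ v i x).HasFiniteMulSupport)
    (hw : ∀ i x, w i (algebraMap K Ω x) = v i x) (hna : {i | ¬ IsNonarchimedean (w i)}.Finite)
    {y : Ω} (hy : IsIntegral K y) : {i | 1 < w i y}.Finite := by
  have h : (⋃ k ∈ (minpoly K y).support, {i | v i ((minpoly K y).coeff k) ≠ 1}).Finite :=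
    Set.Finite.biUnion (Finset.finite_toSet _) fun k hk ↦ hv _ (mem_support_iff.1 hk)
  refine (hna.union h).subset fun i hi ↦ ?_
  by_contra hcon
  simp only [Set.mem_union, Set.mem_ofPred_eq, Set.mem_iUnion, not_or, not_not, not_exists] at hcon
  refine absurd hi (not_lt.2 (hcon.1.apply_le_one_of_monic (minpoly.monic hy) (minpoly.aeval K y)
    fun k ↦ ?_))
  rw [hw]
  by_cases hk : k ∈ (minpoly K y).support
  · exact (hcon.2 k hk).le
  · simp [notMem_support_iff.1 hk]

/-- The previous bound is applied to both `y` and `y⁻¹`. -/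
theorem hasFiniteMulSupport_of_isAlgebraic
    (hv : ∀ x, x ≠ 0 → (fun i ↦ v i x).HasFiniteMulSupport)
    (hw : ∀ i x, w i (algebraMap K Ω x) = v i x) (hna : {i | ¬ IsNonarchimedean (w i)}.Finite)
    {y : Ω} (hy : IsIntegral K y) (hy0 : y ≠ 0) : (fun i ↦ w i y).HasFiniteMulSupport := by
  refine ((finite_setOf_one_lt_of_isAlgebraic hv hw hna hy).union
    (finite_setOf_one_lt_of_isAlgebraic hv hw hna hy.inv)).subset fun i hi ↦ ?_
  rcases lt_or_gt_of_ne (show w i y ≠ 1 from hi) with h | h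
  · right
    rw [Set.mem_ofPred_eq, map_inv₀]
    exact (one_lt_inv₀ ((w i).pos hy0)).2 h
  · exact Or.inl h

/-- The absolute values on `E` induced by its embeddings into a field `Ω` with absolute values. -/
def embeddingFamily (w : V → AbsoluteValue Ω ℝ) (i : V × (E →ₐ[K] Ω)) : AbsoluteValue E ℝ :=
  (w i.1).comp (f := i.2.toRingHom) i.2.toRingHom.injective

theorem embeddingFamily_apply (i : V × (E →ₐ[K] Ω)) (x : E) :
    embeddingFamily w i x = w i.1 (i.2 x) := rfl

theorem embeddingFamily_algebraMap (hw : ∀ i x, w i (algebraMap K Ω x) = v i x)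
    (i : V × (E →ₐ[K] Ω)) (x : K) : embeddingFamily w i (algebraMap K E x) = v i.1 x := by
  rw [embeddingFamily_apply, AlgHom.commutes, hw]

variable [FiniteDimensional K E]

theorem hasFiniteMulSupport_embeddingFamily
    (hv : ∀ x, x ≠ 0 → (fun i ↦ v i x).HasFiniteMulSupport)
    (hw : ∀ i x, w i (algebraMap K Ω x) = v i x) (hna : {i | ¬ IsNonarchimedean (w i)}.Finite)
    {x : E} (hx : x ≠ 0) :
    (fun i : V × (E →ₐ[K] Ω) ↦ embeddingFamily w i x).HasFiniteMulSupport := by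
  have h : (⋃ σ : E →ₐ[K] Ω, (fun i ↦ (i, σ)) '' {i | w i (σ x) ≠ 1}).Finite :=
    Set.finite_iUnion fun σ ↦ Set.Finite.image _ <| hasFiniteMulSupport_of_isAlgebraic hv hw hna
      ((Algebra.IsIntegral.isIntegral x).map σ) (by simpa using hx)
  refine h.subset fun i hi ↦ Set.mem_iUnion.2 ⟨i.2, i.1, hi, rfl⟩

variable [IsAlgClosed Ω] [Algebra.IsSeparable K E]

/-- A bound for the sum of the conjugates of a product in terms of the conjugates of its factors. -/
theorem AbsoluteValue.sum_embeddings_le (u : AbsoluteValue Ω ℝ) (C : ℝ) (hC1 : 1 ≤ C)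
    (hC : IsNonarchimedean u ∨ (Fintype.card (E →ₐ[K] Ω) : ℝ) ≤ C) (x b : E) :
    u (∑ σ : E →ₐ[K] Ω, σ (x * b)) ≤
      C * (∏ σ : E →ₐ[K] Ω, max (u (σ x)) 1) * ∏ σ : E →ₐ[K] Ω, max (u (σ b)) 1 := by
  set X := ∏ σ : E →ₐ[K] Ω, max (u (σ x)) 1
  set B := ∏ σ : E →ₐ[K] Ω, max (u (σ b)) 1
  have hle (y : E) (σ : E →ₐ[K] Ω) : u (σ y) ≤ ∏ σ : E →ₐ[K] Ω, max (u (σ y)) 1 := by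
    classical
    refine (le_max_left _ 1).trans ?_
    rw [← Finset.mul_prod_erase _ _ (Finset.mem_univ σ)]
    exact le_mul_of_one_le_right (by positivity)
      (one_le_prod_of_one_le fun _ _ ↦ le_max_right _ _)
  have hX : 0 ≤ X := by positivity
  have hterm (σ : E →ₐ[K] Ω) : u (σ (x * b)) ≤ X * B := by
    rw [map_mul, map_mul]
    exact mul_le_mul (hle x σ) (hle b σ) (u.nonneg _) hX
  have hXB : 0 ≤ X * B := by positivity
  rw [mul_assoc]
  rcases hC with hC | hC
  · have : Nonempty (E →ₐ[K] Ω) := ⟨IsAlgClosed.lift⟩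
    obtain ⟨σ, -, hσ⟩ := hC.finset_image_add u.map_zero u.nonneg (fun σ : E →ₐ[K] Ω ↦ σ (x * b)) Finset.univ
    exact hσ.trans ((hterm σ).trans (le_mul_of_one_le_left hXB hC1))
  · refine (u.sum_le _ _).trans ((Finset.sum_le_card_nsmul _ _ _ fun σ _ ↦ hterm σ).trans ?_)
    rw [nsmul_eq_mul, Finset.card_univ]
    exact mul_le_mul_of_nonneg_right hC hXB

/-- This reduces Northcott for `E` to Northcott for `K`. The local constant is `1` at nonarchimedean
places, so the product of the constants is finite. -/
theorem exists_familyHeight_trace_le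
    (hv : ∀ x, x ≠ 0 → (fun i ↦ v i x).HasFiniteMulSupport)
    (hw : ∀ i x, w i (algebraMap K Ω x) = v i x) (hna : {i | ¬ IsNonarchimedean (w i)}.Finite) :
    ∃ M ≥ 0, ∀ x b : E, familyHeight v (Algebra.trace K E (x * b)) ≤
      M * familyHeight (embeddingFamily (K := K) w) x *
        familyHeight (embeddingFamily (K := K) w) b := by
  classical
  let n : ℝ := max (Fintype.card (E →ₐ[K] Ω)) 1
  let C : V → ℝ := fun i ↦ if IsNonarchimedean (w i) then 1 else n
  have hC1 (i) : 1 ≤ C i := by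
    simp only [C]; split_ifs
    · exact le_rfl
    · exact le_max_right _ _
  have hC : C.HasFiniteMulSupport := hna.subset fun i hi h ↦ hi (if_pos h)
  have hfin (y : E) : (fun i : V × (E →ₐ[K] Ω) ↦
      max (embeddingFamily w i y) 1).HasFiniteMulSupport :=
    hasFiniteMulSupport_max_one
      (fun x hx ↦ hasFiniteMulSupport_embeddingFamily hv hw hna hx) y
  have hfin' (y : E) : (fun i ↦ ∏ σ : E →ₐ[K] Ω, max (w i (σ y)) 1).HasFiniteMulSupport := by
    refine ((hfin y).image Prod.fst).subset fun i hi ↦ ?_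
    by_contra hcon
    refine hi (Finset.prod_eq_one fun σ _ ↦ ?_)
    by_contra h
    exact hcon ⟨(i, σ), h, rfl⟩
  have hheight (y : E) : familyHeight (embeddingFamily (K := K) w) y =
      ∏ᶠ i, ∏ σ : E →ₐ[K] Ω, max (w i (σ y)) 1 := by
    rw [familyHeight, finprod_curry _ (hfin y)]
    exact finprod_congr fun i ↦ finprod_eq_prod_of_fintype _
  refine ⟨∏ᶠ i, C i, zero_le_one.trans (one_le_finprod_of_one_le hC1), fun x b ↦ ?_⟩
  have hCx : (fun i ↦ C i * ∏ σ : E →ₐ[K] Ω, max (w i (σ x)) 1).HasFiniteMulSupport :=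
    hC.mul (hfin' x)
  rw [hheight, hheight, ← finprod_mul_distrib hC (hfin' x), ← finprod_mul_distrib hCx (hfin' b)]
  refine finprod_le_finprod_of_one_le (hasFiniteMulSupport_max_one hv _)
    (hCx.mul (hfin' b)) (fun i ↦ by positivity) fun i ↦ max_le ?_ ?_
  · rw [← hw, trace_eq_sum_embeddings Ω]
    refine (w i).sum_embeddings_le (C i) (hC1 i) ?_ x b
    by_cases h : IsNonarchimedean (w i)
    · exact Or.inl h
    · right
      simp only [C, if_neg h]
      exact le_max_left _ _
  · exact one_le_mul_of_one_le_of_one_le (one_le_mul_of_one_le_of_one_le (hC1 i)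
      (one_le_prod_of_one_le fun _ _ ↦ le_max_right _ _))
      (one_le_prod_of_one_le fun _ _ ↦ le_max_right _ _)

theorem IsGlobalFamily.embeddingFamily (hv : IsGlobalFamily v)
    (hw : ∀ i x, w i (algebraMap K Ω x) = v i x) (hna : {i | ¬ IsNonarchimedean (w i)}.Finite) :
    IsGlobalFamily (embeddingFamily (K := K) (E := E) w) where
  isNontrivial i := by
    obtain ⟨x, hx0, hx⟩ := hv.isNontrivial i.1
    exact ⟨algebraMap K E x, by simpa using hx0, by rwa [embeddingFamily_algebraMap hw]⟩
  finite_isEquiv i := by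
    -- Equivalent members restrict to equivalent absolute values on `K`, and there are only finitely
    -- many embeddings.
    refine ((hv.finite_isEquiv i.1).prod Set.finite_univ).subset fun j hj ↦ ⟨fun x y ↦ ?_, trivial⟩
    rw [← embeddingFamily_algebraMap hw j, ← embeddingFamily_algebraMap hw j,
      ← embeddingFamily_algebraMap hw i, ← embeddingFamily_algebraMap hw i]
    exact hj _ _
  finite_mulSupport x hx := hasFiniteMulSupport_embeddingFamily hv.finite_mulSupport hw hna hx
  finprod_eq_one x hx := by
    rw [finprod_curry _ (hasFiniteMulSupport_embeddingFamily hv.finite_mulSupport hw hna hx),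
      ← hv.finprod_eq_one (Algebra.norm K x) (by simpa [Algebra.norm_eq_zero_iff] using hx)]
    -- For a fixed place of `K`, the product over the embeddings is the absolute value of the norm.
    refine finprod_congr fun i ↦ ?_
    rw [finprod_eq_prod_of_fintype, ← hw, Algebra.norm_eq_prod_embeddings, map_prod]
    rfl
  northcott B := by
    obtain ⟨M, hM, h⟩ := exists_familyHeight_trace_le (E := E) hv.finite_mulSupport hw hna
    let b := Module.finBasis K E
    have hfin : (Set.univ.pi fun k ↦ {y | familyHeight v y ≤
        M * B * familyHeight (_root_.embeddingFamily (K := K) w) (b k)}).Finite :=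
      Set.Finite.pi fun k ↦ hv.northcott _
    -- The traces `Tr (x * b k)` have bounded height, and they determine `x` because the trace form
    -- of a separable extension is nondegenerate.
    refine (hfin.preimage (f := fun x k ↦ Algebra.trace K E (x * b k)) ?_).subset fun x hx k _ ↦ ?_
    · intro x _ y _ hxy
      have hxy' : Algebra.traceForm K E x = Algebra.traceForm K E y :=
        b.ext fun k ↦ congrFun hxy k
      rw [← sub_eq_zero]
      refine (traceForm_nondegenerate K E).1 (x - y) fun z ↦ ?_
      rw [map_sub, hxy', sub_self, LinearMap.zero_apply]
    · refine (h x (b k)).trans (mul_le_mul_of_nonneg_right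
        (mul_le_mul_of_nonneg_left hx hM) (zero_le_one.trans (one_le_familyHeight _ _)))

end Extension

/-! ### Purely inseparable extensions and the passage to `F`. -/

/-- The properties of a global family carry over to a purely inseparable extension of finite
exponent. -/
theorem IsGlobalFamily.of_forall_pow_mem {E F ι : Type*} [Field E] [Field F] [Algebra E F]
    {u : ι → AbsoluteValue E ℝ} {u' : ι → AbsoluteValue F ℝ} (hu : IsGlobalFamily u)
    (huu : ∀ i x, u' i (algebraMap E F x) = u i x) {q : ℕ} (hq : q ≠ 0)
    (h : ∀ x : F, ∃ y : E, algebraMap E F y = x ^ q) : IsGlobalFamily u' := by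
  choose g hg using h
  have hpow (i : ι) (x : F) : u' i x ^ q = u i (g x) := by rw [← map_pow, ← hg, huu]
  have hg0 (x : F) (hx : x ≠ 0) : g x ≠ 0 := by
    intro h0
    have := hg x
    rw [h0, map_zero] at this
    exact pow_ne_zero q hx this.symm
  have hfin (x : F) (hx : x ≠ 0) : (fun i ↦ u' i x).HasFiniteMulSupport := by
    refine (hu.finite_mulSupport _ (hg0 x hx)).subset fun i hi h1 ↦ hi ?_
    exact (pow_eq_one_iff_of_nonneg ((u' i).nonneg x) hq).1 ((hpow i x).trans h1)
  refine ⟨fun i ↦ ?_, fun i ↦ ?_, hfin, fun x hx ↦ ?_, fun B ↦ ?_⟩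
  · obtain ⟨x, hx0, hx⟩ := hu.isNontrivial i
    exact ⟨algebraMap E F x, by simpa using hx0, by rwa [huu]⟩
  · refine (hu.finite_isEquiv i).subset fun j hj x y ↦ ?_
    rw [← huu, ← huu, ← huu i, ← huu i]
    exact hj _ _
  · refine (pow_eq_one_iff_of_nonneg (finprod_nonneg fun i ↦ (u' i).nonneg x) hq).1 ?_
    rw [finprod_pow (hfin x hx), ← hu.finprod_eq_one _ (hg0 x hx)]
    exact finprod_congr fun i ↦ hpow i x
  -- The height of `g x` is the `q`-th power of that of `x`, and the fibres of `g` are finite since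
  -- an element has finitely many `q`-th roots.
  · refine Set.Finite.subset (Set.Finite.preimage' (f := g) (hu.northcott (B ^ q)) fun y _ ↦ ?_)
      fun x hx ↦ ?_
    · refine (finite_setOfPred_isRoot (X_pow_sub_C_ne_zero (Nat.pos_of_ne_zero hq)
        (algebraMap E F y))).subset fun x hx ↦ ?_
      have : g x = y := hx
      simp [← this, hg]
    · have heq : familyHeight u (g x) = familyHeight u' x ^ q := by
        rw [familyHeight, familyHeight, finprod_pow (hasFiniteMulSupport_max_one hfin x)]
        refine finprod_congr fun i ↦ ?_
        have hmono : MonotoneOn (fun y : ℝ ↦ y ^ q) (Set.Ici 0) :=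
          fun a ha b _ hab ↦ pow_le_pow_left₀ ha hab q
        have := hmono.map_max (a := u' i x) (b := 1) ((u' i).nonneg x) (Set.mem_Ici.2 zero_le_one)
        simpa [hpow] using this.symm
      rw [Set.mem_preimage, Set.mem_ofPred_eq, heq]
      exact pow_le_pow_left₀ (zero_le_one.trans (one_le_familyHeight _ _)) hx q

open IsDedekindDomain in
/-- A finite extension of a field with an absolute value at infinity carries a global family of
absolute values that extend to the algebraic closure. -/
theorem IsInftyAbsoluteValue.exists_isGlobalFamily {A K F : Type*} [CommRing A] [IsDomain A]
    [IsPrincipalIdealRing A] [Field K] [Algebra A K] [IsFractionRing A K] [Field F] [Algebra K F]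
    [FiniteDimensional K F] {a : AbsoluteValue K ℝ} (ha : IsInftyAbsoluteValue A a)
    (hext : ∃ w : AbsoluteValue (AlgebraicClosure F) ℝ, ∀ x, w (algebraMap K _ x) = a x) :
    ∃ u : Option (HeightOneSpectrum A) × (separableClosure K F →ₐ[K] AlgebraicClosure F) →
        AbsoluteValue F ℝ, IsGlobalFamily u ∧
      ∀ i, ∃ w : AbsoluteValue (AlgebraicClosure F) ℝ, w.LiesOver (u i) := by
  have : Algebra.IsAlgebraic K (AlgebraicClosure F) := Algebra.IsAlgebraic.trans K F _
  have : Algebra.IsAlgebraic (separableClosure K F) (AlgebraicClosure F) :=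
    Algebra.IsAlgebraic.tower_top (K := K) _
  have hw : ∀ i, ∃ w : AbsoluteValue (AlgebraicClosure F) ℝ,
      (∀ x, w (algebraMap K _ x) = ha.family i x) ∧ (i ≠ none → IsNonarchimedean w) := by
    intro i
    cases i with
    | none => exact hext.imp fun w hw ↦ ⟨hw, fun h ↦ absurd rfl h⟩
    | some P =>
      obtain ⟨w, h1, h2⟩ := exists_isNonarchimedean_extension (L := AlgebraicClosure F)
        (ha.family (some P)) (ha.isNontrivial_family _) (ha.isNonarchimedean_family_some P)
      exact ⟨w, h2, fun _ ↦ h1⟩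
  choose w hw hna using hw
  have hna' : {i | ¬ IsNonarchimedean (w i)}.Finite :=
    (Set.finite_singleton none).subset fun i hi ↦ not_not.1 fun h ↦ hi (hna i h)
  have hE := ha.isGlobalFamily.embeddingFamily (E := separableClosure K F) hw hna'
  -- Extending `σ` to the algebraic closure makes `w ∘ τ` an absolute value there. It restricts on
  -- the separable closure to the member of the family given by `σ`, and it lies over its own
  -- restriction to `F`.
  have hτ : ∀ σ : separableClosure K F →ₐ[K] AlgebraicClosure F,
      ∃ τ : AlgebraicClosure F →ₐ[K] AlgebraicClosure F,
        ∀ x, τ (algebraMap _ _ x) = σ x := by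
    intro σ
    obtain ⟨τ, rfl⟩ := IsAlgClosed.surjective_domRestrict_of_isAlgebraic
      (K := K) (L := separableClosure K F) (E := AlgebraicClosure F) (M := AlgebraicClosure F) σ
    exact ⟨τ, fun x ↦ rfl⟩
  choose τ hτ using hτ
  refine ⟨fun i ↦ ((w i.1).comp (f := (τ i.2).toRingHom) (τ i.2).toRingHom.injective).comp
    (algebraMap F (AlgebraicClosure F)).injective, ?_, fun i ↦ ⟨_, ⟨rfl⟩⟩⟩
  -- In characteristic zero `ringExpChar K` is `1`, so `q = 1` and the step is harmless.
  refine hE.of_forall_pow_mem (q := ringExpChar K ^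
    IsPurelyInseparable.exponent (separableClosure K F) F) (fun i x ↦ ?_)
    (pow_ne_zero _ (expChar_pos K _).ne') fun x ↦ ?_
  · change w i.1 (τ i.2 (algebraMap F _ (algebraMap _ F x))) = w i.1 (i.2 x)
    rw [← IsScalarTower.algebraMap_apply, hτ]
  · exact IsPurelyInseparable.exponent_def' (separableClosure K F) (ringExpChar K) x


/-! ### The places at infinity of `ℚ` and of `𝔽_p(T)`. -/

theorem isInftyAbsoluteValue_rat : IsInftyAbsoluteValue ℤ Rat.AbsoluteValue.real where
  isNontrivial := ⟨2, by norm_num, by norm_num⟩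
  isUnit x hx := by
    rcases Int.isUnit_iff.1 hx with rfl | rfl <;> simp
  one_lt x hx0 hx := by
    have : 1 < |x| := by
      rw [Int.isUnit_iff_abs_eq] at hx
      have := Int.one_le_abs hx0
      omega
    simpa using mod_cast this
  finite_le B := by
    refine (Set.finite_Icc (-⌊B⌋) ⌊B⌋).subset fun x hx ↦ abs_le.1 (Int.le_floor.2 ?_)
    simpa using hx

section RatFunc

variable {k : Type*} [Field k]

open scoped Classical in
/-- The absolute value at infinity of a field of rational functions. -/
def ratFuncInftyAbs (k : Type*) [Field k] : AbsoluteValue (RatFunc k) ℝ where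
  -- Any base greater than `1` would serve, since the `P`-adic absolute values are normalized
  -- relative to this one.
  toFun x := (WithZeroMulInt.toNNReal (e := 2) two_ne_zero (RatFunc.inftyValuation k x) : ℝ)
  map_mul' _ _ := by simp
  nonneg' _ := NNReal.zero_le_coe
  eq_zero' _ := by simp
  add_le' x y := by
    have h := (WithZeroMulInt.toNNReal_strictMono (e := 2) one_lt_two).monotone
    have h1 := h ((RatFunc.inftyValuation k).map_add x y)
    rw [h.map_max] at h1
    exact mod_cast h1.trans (max_le_add_of_nonneg zero_le zero_le)

theorem isNonarchimedean_ratFuncInftyAbs : IsNonarchimedean (ratFuncInftyAbs k) := by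
  classical
  intro x y
  have h := (WithZeroMulInt.toNNReal_strictMono (e := 2) one_lt_two).monotone
  have h1 := h ((RatFunc.inftyValuation k).map_add x y)
  rw [h.map_max] at h1
  exact mod_cast h1

theorem ratFuncInftyAbs_algebraMap {f : k[X]} (hf : f ≠ 0) :
    ratFuncInftyAbs k (algebraMap k[X] (RatFunc k) f) = 2 ^ f.natDegree := by
  classical
  have h : ratFuncInftyAbs k (algebraMap k[X] (RatFunc k) f) = (WithZeroMulInt.toNNReal (e := 2)
    two_ne_zero (RatFunc.inftyValuation k (algebraMap k[X] (RatFunc k) f)) : ℝ) := rfl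
  rw [h, RatFunc.inftyValuation_apply, RatFunc.inftyValuation.polynomial k hf,
    WithZeroMulInt.toNNReal_neg_apply _ WithZero.exp_ne_zero]
  exact zpow_natCast (2 : ℝ) f.natDegree

theorem isInftyAbsoluteValue_ratFunc [Finite k] :
    IsInftyAbsoluteValue k[X] (ratFuncInftyAbs k) where
  isNontrivial := ⟨algebraMap k[X] (RatFunc k) X, by simp [RatFunc.X_ne_zero], by
    rw [ratFuncInftyAbs_algebraMap X_ne_zero]; simp⟩
  isUnit f hf := by
    rw [ratFuncInftyAbs_algebraMap hf.ne_zero, natDegree_eq_zero_of_isUnit hf, pow_zero]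
  one_lt f hf0 hf := by
    rw [ratFuncInftyAbs_algebraMap hf0]
    refine one_lt_pow₀ one_lt_two fun h ↦ hf ?_
    exact (isUnit_iff_degree_eq_zero).2 ((degree_eq_iff_natDegree_eq hf0).2 h)
  finite_le B := by
    obtain ⟨n, hn⟩ := pow_unbounded_of_one_lt B (one_lt_two (α := ℝ))
    -- Bounded size means bounded degree, and over a finite field there are finitely many such
    -- polynomials.
    have : Finite (degreeLT k n) := Finite.of_equiv _ (degreeLTEquiv k n).toEquiv.symm
    refine (Set.toFinite (degreeLT k n : Set k[X])).subset fun f hf ↦ ?_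
    by_cases hf0 : f = 0
    · rw [hf0]; exact zero_mem _
    rw [Set.mem_ofPred_eq, ratFuncInftyAbs_algebraMap hf0] at hf
    rw [SetLike.mem_coe, mem_degreeLT, ← natDegree_lt_iff_degree_lt hf0]
    exact (pow_lt_pow_iff_right₀ (one_lt_two (α := ℝ))).1 (hf.trans_lt hn)

end RatFunc

end

/-! ### The theorem for number fields and for function fields. -/

theorem mainTheorem8 {F : Type*} [Field F] (hF : IsGlobalField F)
    (S : Finset (Place F))
    (hS : ∀ (v : AbsoluteValue F ℝ) (hv : v.IsNontrivial), ¬ IsNonarchimedean v → Place.mk v hv ∈ S)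
    (φ : RatFunc F) (hφ : φ ≠ 0)
    (t : ℕ) (ht : S.card < t) (f : Fin t → F[X])
    (hirr : ∀ i, Irreducible (f i))
    (hdist : ∀ i j, i ≠ j → ¬ Associated (f i) (f j))
    (hdvd : ∀ i, f i ∣ φ.num) :
    {α : F | IsIntegralTo (S : Set (Place F)) (zeroSet φ) α}.Finite := by
  rcases hF with hF | ⟨p, hp, hA, hF⟩
  · obtain ⟨u, hu, hext⟩ := isInftyAbsoluteValue_rat.exists_isGlobalFamily (F := F) <| by
      have : Algebra.IsAlgebraic ℚ (AlgebraicClosure F) := Algebra.IsAlgebraic.trans _ F _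
      -- The real absolute value of `ℚ` extends through an embedding into `ℂ`.
      let s : AlgebraicClosure F →ₐ[ℚ] ℂ := IsAlgClosed.lift
      refine ⟨(NormedField.toAbsoluteValue ℂ).comp (f := s.toRingHom) s.toRingHom.injective,
        fun x ↦ ?_⟩
      change ‖s (algebraMap ℚ _ x)‖ = Rat.AbsoluteValue.real x
      rw [s.commutes]
      simp
    exact finite_setOf_isIntegralTo hu hext S φ t ht f hirr hdist hdvd
  · have : FiniteDimensional (RatFunc (ZMod p)) F := hF
    have : Algebra.IsAlgebraic (RatFunc (ZMod p)) (AlgebraicClosure F) :=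
      Algebra.IsAlgebraic.trans _ F _
    have ha := isInftyAbsoluteValue_ratFunc (k := ZMod p)
    obtain ⟨w, -, hw⟩ := exists_isNonarchimedean_extension (L := AlgebraicClosure F)
      (ratFuncInftyAbs (ZMod p)) ha.isNontrivial isNonarchimedean_ratFuncInftyAbs
    obtain ⟨u, hu, hext⟩ := ha.exists_isGlobalFamily (F := F) ⟨w, hw⟩
    exact finite_setOf_isIntegralTo hu hext S φ t ht f hirr hdist hdvd
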